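/- **Definitions.** Let $\mathcal M$ be a von Neumann algebra acting on a complex Hilbert space, with a (finite) faithful normal tracial positive linear functional $\tau$. For $x\in\mathcal M$ put $|x|=(x^*x)^{1/2}$ and $\|x\|_1=\tau(|x|)$, and let $L^1(\mathcal M)$ be the noncommutative $L^1$-space, in which $\mathcal M$ is a dense subspace for $\|\cdot\|_1$. Let $k>0$. A *good $k$-convolution* is a bilinear map $\ast:\mathcal M\times\mathcal M\to L^1(\mathcal M)$ such that 1. $x\ast y\ge 0$ for all $x,y\in\mathcal M$ with $x,y\ge0$; 2. $\|x\ast y\|_1\le k\|x\|_1\|y\|_1$ for all $x,y\in\mathcal M$; 3. $\tau(x\ast y)=k\,\tau(x)\tau(y)$ for all $x,y\in\mathcal M$. An *antipode* is a trace-preserving (linear, bijective) anti-$*$-isomorphism $\rho$ of $\mathcal M$ such that $$\tau((x\ast y)z)=\tau((\rho(z)\ast x)\rho(y))\qquad\text{for all }x,y,z\in\mathcal M .$$ The quadruple $(\mathcal M,\tau,\ast,\rho)$ is then called a *Frobenius von Neumann $k$-algebra* (FN $k$-algebra). For a positive operator $x\in\mathcal M$, its von Neumann entropy is $H(x)=\tau(-x\log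 x)$, with the convention $0\log 0=0$. **Theorem (quantum entropic convolution inequality).** Let $(\mathcal M,\tau,\ast,\rho)$ be an FN $k$-algebra, and let $x,y\in\mathcal M$ be positive operators with $\|x\|_1=\|y\|_1=k^{-1}$. Then $x\ast y$ is a positive operator in $\mathcal M$, and for every $\theta\in[0,1]$, $$H(x\ast y)\ \ge\ \theta H(x)+(1-\theta)H(y).$$ -/

import Mathlib

open scoped ComplexOrder InnerProductSpace

noncomputable section

namespace FrobeniusVN

variable {H : Type*} [NormedAddCommGroup H] [InnerProductSpace ℂ H] [CompleteSpace H]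

/-- A von Neumann algebra is norm closed, so that its carrier is a C⋆-algebra. -/
instance instIsClosed (M : VonNeumannAlgebra H) :
    IsClosed (M.toStarSubalgebra : Set (H →L[ℂ] H)) := by
  have h : (M.toStarSubalgebra : Set (H →L[ℂ] H)) =
      Set.centralizer (Set.centralizer (M : Set (H →L[ℂ] H))) := by simp
  rw [h]
  exact Set.isClosed_centralizer _

/-- The C⋆-algebra underlying a von Neumann algebra `M` acting on `H`. -/
abbrev Alg (M : VonNeumannAlgebra H) : Type _ := M.toStarSubalgebra

/-- An element of `M` is positive if it is a positive operator on `H`. -/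
def IsPos {M : VonNeumannAlgebra H} (x : Alg M) : Prop := (x : H →L[ℂ] H).IsPositive

/-- A linear functional on `M` is normal (ultraweakly continuous) if it has the form
`x ↦ ∑ₙ ⟪ηₙ, x ξₙ⟫` with `∑ₙ ‖ξₙ‖² < ∞` and `∑ₙ ‖ηₙ‖² < ∞`. -/
def IsNormal {M : VonNeumannAlgebra H} (φ : StrongDual ℂ (Alg M)) : Prop :=
  ∃ ξ η : ℕ → H, Summable (fun n => ‖ξ n‖ ^ 2) ∧ Summable (fun n => ‖η n‖ ^ 2) ∧
    ∀ x : Alg M, HasSum (fun n => ⟪η n, (x : H →L[ℂ] H) (ξ n)⟫_ℂ) (φ x)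

/-- `τ` is a faithful normal tracial positive linear functional on `M`. It is finite, being
defined on all of `M`; norm continuity is automatic for a positive functional. -/
structure IsTrace {M : VonNeumannAlgebra H} (τ : StrongDual ℂ (Alg M)) : Prop where
  pos : ∀ x : Alg M, IsPos x → 0 ≤ τ x
  faithful : ∀ x : Alg M, τ (star x * x) = 0 → x = 0
  tracial : ∀ x y : Alg M, τ (x * y) = τ (y * x)
  normal : IsNormal τ

/-- The absolute value `|x| = (x* x)^{1/2}`. -/
def absVal {M : VonNeumannAlgebra H} (x : Alg M) : Alg M := cfc Real.sqrt (star x * x)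

/-- The noncommutative `1`-norm `‖x‖₁ = τ(|x|)` of an element of `M`. -/
def norm₁ {M : VonNeumannAlgebra H} (τ : StrongDual ℂ (Alg M)) (x : Alg M) : ℝ :=
  (τ (absVal x)).re

/-- The von Neumann entropy `H(x) = τ(-x log x)` of a positive element `x` of `M`. -/
def entropy {M : VonNeumannAlgebra H} (τ : StrongDual ℂ (Alg M)) (x : Alg M) : ℝ :=
  (τ (cfc Real.negMulLog x)).re

/-- An element `x` of `M`, regarded as the functional `z ↦ τ(x z)`. -/
def density {M : VonNeumannAlgebra H} (τ : StrongDual ℂ (Alg M)) :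
    Alg M →ₗ[ℂ] StrongDual ℂ (Alg M) where
  toFun x := τ.comp (ContinuousLinearMap.mul ℂ (Alg M) x)
  map_add' x y := by ext z; simp
  map_smul' c x := by ext z; simp

/-- The noncommutative space `L¹(M, τ)`: the completion of `M` in the `1`-norm. An operator
`h ∈ L¹` is represented by the functional `z ↦ τ(h z)` on `M`, whose norm is `‖h‖₁`; so `L¹`
is the norm closure of the functionals `z ↦ τ(x z)`, `x ∈ M`, in the dual of `M`. -/
def L1 {M : VonNeumannAlgebra H} (τ : StrongDual ℂ (Alg M)) :
    Submodule ℂ (StrongDual ℂ (Alg M)) :=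
  (LinearMap.range (density τ)).topologicalClosure

/-- The inclusion `M ⊆ L¹(M, τ)`. -/
def toL1 {M : VonNeumannAlgebra H} (τ : StrongDual ℂ (Alg M)) : Alg M →ₗ[ℂ] L1 τ :=
  (density τ).codRestrict (L1 τ) fun x =>
    Submodule.le_topologicalClosure _ (LinearMap.mem_range_self _ x)

/-- The pairing `τ(h z)` of `h ∈ L¹(M, τ)` with `z ∈ M`. -/
def pairing {M : VonNeumannAlgebra H} {τ : StrongDual ℂ (Alg M)} (h : L1 τ) (z : Alg M) : ℂ :=
  (h : StrongDual ℂ (Alg M)) z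

/-- A good `k`-convolution: a bilinear map `M × M → L¹(M, τ)` with positivity, the primary
Young inequality `‖x ∗ y‖₁ ≤ k ‖x‖₁ ‖y‖₁`, and the Haar measure property
`τ(x ∗ y) = k τ(x) τ(y)`. -/
structure IsGoodConvolution {M : VonNeumannAlgebra H} (τ : StrongDual ℂ (Alg M)) (k : ℝ)
    (conv : Alg M →ₗ[ℂ] Alg M →ₗ[ℂ] L1 τ) : Prop where
  positivity : ∀ x y : Alg M, IsPos x → IsPos y →
    ∀ z : Alg M, IsPos z → 0 ≤ pairing (conv x y) z
  young : ∀ x y : Alg M, ‖conv x y‖ ≤ k * norm₁ τ x * norm₁ τ y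
  haar : ∀ x y : Alg M, pairing (conv x y) 1 = k * τ x * τ y

/-- An antipode for a convolution: a trace-preserving anti-⋆-isomorphism `ρ` of `M` satisfying
Frobenius reciprocity `τ((x ∗ y) z) = τ((ρ(z) ∗ x) ρ(y))`. -/
structure IsAntipode {M : VonNeumannAlgebra H} (τ : StrongDual ℂ (Alg M))
    (conv : Alg M →ₗ[ℂ] Alg M →ₗ[ℂ] L1 τ) (ρ : Alg M ≃ₗ[ℂ] Alg M) : Prop where
  map_mul : ∀ x y : Alg M, ρ (x * y) = ρ y * ρ x
  map_star : ∀ x : Alg M, ρ (star x) = star (ρ x)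
  trace_map : ∀ x : Alg M, τ (ρ x) = τ x
  reciprocity : ∀ x y z : Alg M,
    pairing (conv x y) z = pairing (conv (ρ z) x) (ρ y)

/-- `(M, τ, ∗, ρ)` is a Frobenius von Neumann `k`-algebra. -/
structure IsFNAlgebra (M : VonNeumannAlgebra H) (τ : StrongDual ℂ (Alg M)) (k : ℝ)
    (conv : Alg M →ₗ[ℂ] Alg M →ₗ[ℂ] L1 τ) (ρ : Alg M ≃ₗ[ℂ] Alg M) : Prop where
  k_pos : 0 < k
  trace : IsTrace τ
  good : IsGoodConvolution τ k conv
  antipode : IsAntipode τ conv ρ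

end FrobeniusVN

end

/-!
For fixed positive `x` with `τ x = k⁻¹`, the bilinear form `Φ(a, b) = τ((x ∗ a) b)` on `M` is
positive, and both its marginals are the trace: `Φ(a, 1) = τ a` by the Haar property, and
`Φ(1, b) = τ b` by Frobenius reciprocity followed by the Haar property. Applying reciprocity twice
gives the same for `Φ(a, b) = τ((a ∗ y) b)`. Hence `a ↦ x ∗ a` and `a ↦ a ∗ y` behave like positive,
unital, trace-preserving maps, and such maps do not decrease the entropy; the two inequalities
`H(x ∗ y) ≥ H(y)` and `H(x ∗ y) ≥ H(x)` give the theorem by convex combination. Everything is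
thus contained in `FrobeniusVN.exists_density_entropy_le`, a statement about one such form `Φ`,
which has two halves.

*Boundedness.* For `y ≥ 0` the functional `Φ(y, ·)` lies between `0` and `‖y‖ τ`, and has to be
shown to be `τ(w ·)` for some `w ∈ M` with `0 ≤ w ≤ ‖y‖`. The functionals of this form make up a
convex set which is weak-⋆ compact, because order intervals of `M` are compact in the weak operator
topology and `τ` is normal (`isClosed_image_density_Icc`). If `Φ(y, ·)` were outside this set,
Hahn–Banach would separate it by some self-adjoint `a ∈ M`; but `w` close to `‖y‖` times the support
projection of `a⁺` contradicts the separation (`exists_density_of_le`).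

*Entropy.* The tangent lines of the concave function `f(t) = -t log t` give
`f(s) ≤ -s log t + t - s`. For a decomposition `1 = ∑ eⱼ`, `y = ∑ sⱼ eⱼ` with `eⱼ ≥ 0`, use this
with `s = sⱼ` and the functional calculus of `w` in place of `t`, apply `Φ(eⱼ, ·)`, and sum over `j`:
this yields `τ(∑ f(sⱼ) eⱼ) ≤ τ(f(w))` (`sum_negMulLog_le`). Bernstein polynomials of `y` provide
decompositions for which `∑ f(sⱼ) eⱼ` is as close to `f(y)` as desired
(`exists_positive_decomposition`).
-/

namespace FrobeniusVN

/-! ### Positive functionals on C⋆-algebras -/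

section CStar

open scoped ComplexStarModule

variable {A : Type*} [CStarAlgebra A] [PartialOrder A] [StarOrderedRing A]

theorem map_mono_of_nonneg {φ : A →ₗ[ℂ] ℂ} (hφ : ∀ a, 0 ≤ a → 0 ≤ φ a) {a b : A} (hab : a ≤ b) :
    φ a ≤ φ b := by
  have := hφ (b - a) (sub_nonneg.2 hab)
  rwa [map_sub, sub_nonneg] at this

theorem im_map_eq_zero_of_isSelfAdjoint {φ : A →ₗ[ℂ] ℂ} (hφ : ∀ a, 0 ≤ a → 0 ≤ φ a) {a : A}
    (ha : IsSelfAdjoint a) : (φ a).im = 0 := by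
  have h₁ := (Complex.nonneg_iff.1 (hφ a⁺ (CFC.posPart_nonneg a))).2
  have h₂ := (Complex.nonneg_iff.1 (hφ a⁻ (CFC.negPart_nonneg a))).2
  rw [← CFC.posPart_sub_negPart a ha, map_sub, Complex.sub_im, ← h₁, ← h₂, sub_zero]

theorem re_map_realPart {φ : A →ₗ[ℂ] ℂ} (hφ : ∀ a, 0 ≤ a → 0 ≤ φ a) (b : A) :
    (φ (ℜ b : A)).re = (φ b).re := by
  conv_rhs => rw [← realPart_add_I_smul_imaginaryPart b]
  simp [im_map_eq_zero_of_isSelfAdjoint hφ (ℑ b).2]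

theorem trace_mul_nonneg {τ : A →ₗ[ℂ] ℂ} (hτ : ∀ a, 0 ≤ a → 0 ≤ τ a)
    (htr : ∀ a b, τ (a * b) = τ (b * a)) {a b : A} (ha : 0 ≤ a) (hb : 0 ≤ b) :
    0 ≤ τ (a * b) := by
  obtain ⟨c, rfl⟩ := CStarAlgebra.nonneg_iff_eq_star_mul_self.1 hb
  rw [← mul_assoc, htr, ← mul_assoc]
  exact hτ _ (star_right_conjugate_nonneg ha c)

/-! ### Jensen's inequality for the entropy function -/

/-- The graph of `s ↦ -s log s` lies below its tangent at `t`. -/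
theorem negMulLog_le_tangent {s t : ℝ} (hs : 0 ≤ s) (ht : 0 < t) :
    Real.negMulLog s ≤ s * -Real.log t + (t - s) := by
  rcases hs.eq_or_lt with rfl | hs
  · simp [ht.le]
  have h := Real.log_le_sub_one_of_pos (div_pos ht hs)
  rw [Real.log_div ht.ne' hs.ne'] at h
  have h' := mul_le_mul_of_nonneg_left h hs.le
  have h2 : s * (t / s - 1) = t - s := by field_simp
  rw [Real.negMulLog]
  linarith

theorem continuousOn_log_add (w : A) (hw : 0 ≤ w) {δ : ℝ} (hδ : 0 < δ) :
    ContinuousOn (fun t : ℝ => -Real.log (t + δ)) (spectrum ℝ w) := by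
  refine ContinuousOn.neg (ContinuousOn.log (by fun_prop) fun t ht => ?_)
  have := spectrum_nonneg_of_nonneg hw ht
  positivity

/-- Jensen's inequality for a decomposition `y = ∑ sⱼ eⱼ`, `1 = ∑ eⱼ` with `eⱼ ≥ 0`, transported by
a positive form `Φ` that pairs `y` with `b` to `τ(w b)`. -/
theorem sum_negMulLog_le {ι : Type*} (J : Finset ι) {τ : A →ₗ[ℂ] ℂ} {Φ : A →ₗ[ℂ] A →ₗ[ℂ] ℂ}
    (hτ : ∀ a, 0 ≤ a → 0 ≤ τ a) (hΦ : ∀ a b, 0 ≤ a → 0 ≤ b → 0 ≤ Φ a b)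
    (hΦ₁ : ∀ b, Φ 1 b = τ b) {y w : A} (hw : 0 ≤ w)
    (hyw : ∀ b, Φ y b = τ (w * b)) {e : ι → A} {s : ι → ℝ} (he : ∀ j ∈ J, 0 ≤ e j)
    (hs : ∀ j ∈ J, 0 ≤ s j) (he₁ : ∑ j ∈ J, e j = 1) (hey : ∑ j ∈ J, (s j : ℂ) • e j = y) :
    ∑ j ∈ J, (Real.negMulLog (s j) : ℂ) * Φ (e j) 1 ≤ τ (cfc Real.negMulLog w) := by
  -- The tangent is taken at `t + δ` rather than `t`, as `0` may lie in the spectrum of `w`.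
  have key : ∀ δ : ℝ, 0 < δ → ∑ j ∈ J, (Real.negMulLog (s j) : ℂ) * Φ (e j) 1 ≤
      τ (cfc Real.negMulLog w) + δ * τ 1 := by
    intro δ hδ
    set l : A := cfc (fun t : ℝ => -Real.log (t + δ)) w with hl
    have hlc := continuousOn_log_add w hw hδ
    have hop : ∀ r : ℝ, 0 ≤ r →
        (Real.negMulLog r : ℂ) • (1 : A) ≤ (r : ℂ) • l + (w + ((δ - r : ℝ) : ℂ) • (1 : A)) := by
      intro r hr
      have h1 : (r : ℂ) • l + (w + ((δ - r : ℝ) : ℂ) • (1 : A)) =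
          cfc (fun t : ℝ => r * -Real.log (t + δ) + (t + (δ - r))) w := by
        rw [cfc_add (a := w) (fun t : ℝ => r * -Real.log (t + δ)) (fun t => t + (δ - r))
          (hlc.const_mul r) (by fun_prop), cfc_const_mul r _ w hlc,
          cfc_add_const (δ - r) (fun t => t) w, cfc_id' ℝ w, Complex.coe_smul, Complex.coe_smul,
          Algebra.algebraMap_eq_smul_one]
      have h2 : (Real.negMulLog r : ℂ) • (1 : A) = cfc (fun _ : ℝ => Real.negMulLog r) w := by
        rw [cfc_const _ w, Algebra.algebraMap_eq_smul_one, Complex.coe_smul]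
      rw [h1, h2]
      refine cfc_mono (fun t ht => ?_) (by fun_prop) ((hlc.const_mul r).add (by fun_prop))
      have ht0 := spectrum_nonneg_of_nonneg hw ht
      have := negMulLog_le_tangent hr (t := t + δ) (by positivity)
      linarith
    have hterm : ∀ j ∈ J, (Real.negMulLog (s j) : ℂ) * Φ (e j) 1 ≤
        Φ ((s j : ℂ) • e j) l + Φ (e j) w + (δ * Φ (e j) 1 - Φ ((s j : ℂ) • e j) 1) := by
      intro j hj
      have h := map_mono_of_nonneg (fun b => hΦ (e j) b (he j hj)) (hop (s j) (hs j hj))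
      simp only [map_smul, map_add, smul_eq_mul, LinearMap.smul_apply] at h ⊢
      refine h.trans_eq ?_
      push_cast
      ring
    have hwl : w * l ≤ cfc Real.negMulLog w := by
      have h1 : w * l = cfc (fun t : ℝ => t * -Real.log (t + δ)) w := by
        rw [cfc_mul (fun t => t) (fun t : ℝ => -Real.log (t + δ)) w (by fun_prop) hlc, cfc_id' ℝ w]
      rw [h1]
      refine cfc_mono (fun t ht => ?_) (continuousOn_id.mul hlc)
        Real.continuous_negMulLog.continuousOn
      have ht0 := spectrum_nonneg_of_nonneg hw ht
      rcases ht0.eq_or_lt with rfl | htp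
      -- At `t = 0` both sides vanish.
      · simp
      · have := mul_le_mul_of_nonneg_left (Real.log_le_log htp (by linarith : t ≤ t + δ)) ht0
        rw [Real.negMulLog]
        linarith
    calc ∑ j ∈ J, (Real.negMulLog (s j) : ℂ) * Φ (e j) 1
        ≤ ∑ j ∈ J, (Φ ((s j : ℂ) • e j) l + Φ (e j) w +
            (δ * Φ (e j) 1 - Φ ((s j : ℂ) • e j) 1)) := Finset.sum_le_sum hterm
      _ = Φ y l + Φ 1 w + (δ * Φ 1 1 - Φ y 1) := by
          have h₁ : ∀ b, Φ 1 b = ∑ j ∈ J, Φ (e j) b := fun b => by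
            rw [← he₁, map_sum, LinearMap.sum_apply]
          have h₂ : ∀ b, Φ y b = ∑ j ∈ J, Φ ((s j : ℂ) • e j) b := fun b => by
            rw [← hey, map_sum, LinearMap.sum_apply]
          rw [h₁, h₁, h₂, h₂, Finset.sum_add_distrib, Finset.sum_add_distrib,
            Finset.sum_sub_distrib, Finset.mul_sum]
      _ = τ (w * l) + δ * τ 1 := by
          rw [hyw, hyw, hΦ₁, hΦ₁, mul_one]
          ring
      _ ≤ _ := by
          gcongr
          exact map_mono_of_nonneg hτ hwl
  -- Now let `δ` tend to `0`.
  have hlim : Filter.Tendsto (fun δ : ℝ => τ (cfc Real.negMulLog w) + (δ : ℂ) * τ 1)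
      (nhdsWithin 0 (Set.Ioi 0)) (nhds (τ (cfc Real.negMulLog w) + ((0 : ℝ) : ℂ) * τ 1)) := by
    refine tendsto_nhdsWithin_of_tendsto_nhds (Continuous.tendsto ?_ 0)
    fun_prop
  rw [Complex.ofReal_zero, zero_mul, add_zero] at hlim
  exact ge_of_tendsto hlim (Filter.eventually_of_mem self_mem_nhdsWithin fun δ hδ => key δ hδ)

theorem sum_bernstein_eq (n : ℕ) (x : ℝ) :
    ∑ j ∈ Finset.range (n + 1), (bernsteinPolynomial ℝ n j).eval x = 1 := by
  simpa [Polynomial.eval_finsetSum] using congr(Polynomial.eval x $(bernsteinPolynomial.sum ℝ n))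

theorem sum_mul_bernstein_eq (n : ℕ) (x : ℝ) :
    ∑ j ∈ Finset.range (n + 1), (j : ℝ) * (bernsteinPolynomial ℝ n j).eval x = n * x := by
  simpa [Polynomial.eval_finsetSum] using
    congr(Polynomial.eval x $(bernsteinPolynomial.sum_smul ℝ n))

theorem bernstein_eval_nonneg {n j : ℕ} {x : ℝ} (h0 : 0 ≤ x) (h1 : x ≤ 1) :
    0 ≤ (bernsteinPolynomial ℝ n j).eval x := by
  have : 0 ≤ 1 - x := by linarith
  simp only [bernsteinPolynomial, Polynomial.eval_mul, Polynomial.eval_natCast,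
    Polynomial.eval_pow, Polynomial.eval_X, Polynomial.eval_sub, Polynomial.eval_one]
  positivity

theorem exists_bernstein_near {f : ℝ → ℝ} (hf : Continuous f) {ε : ℝ} (hε : 0 < ε) :
    ∃ n : ℕ, n ≠ 0 ∧ ∀ x ∈ Set.Icc (0 : ℝ) 1,
      |∑ j ∈ Finset.range (n + 1), f (j / n) * (bernsteinPolynomial ℝ n j).eval x - f x| ≤ ε := by
  let F : C(unitInterval, ℝ) := ⟨fun x => f x, by fun_prop⟩
  obtain ⟨n, hn, hn0⟩ := (((Metric.tendsto_nhds.1 (bernsteinApproximation_uniform F)) ε hε).and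
    (Filter.eventually_ne_atTop 0)).exists
  refine ⟨n, hn0, fun x hx => ?_⟩
  have h := (ContinuousMap.dist_apply_le_dist (f := bernsteinApproximation n F) (g := F)
    ⟨x, hx⟩).trans hn.le
  rw [Real.dist_eq, bernsteinApproximation.apply] at h
  rw [Finset.sum_range]
  simpa [F, bernstein, bernstein.z, Polynomial.toContinuousMapOn, mul_comm] using h

/-- A positive element `y` has decompositions `y = ∑ sⱼ eⱼ`, `1 = ∑ eⱼ` with `eⱼ ≥ 0`, `sⱼ ≥ 0` for which
`∑ f(sⱼ) eⱼ` is norm close to `f(y)`: take for `eⱼ` the Bernstein polynomials of `y / C`, where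
`C ≥ ‖y‖`, and `sⱼ = C j / n`. They reproduce affine functions, so that both sums are exact. -/
theorem exists_positive_decomposition {y : A} (hy : 0 ≤ y) {f : ℝ → ℝ} (hf : Continuous f) {ε : ℝ}
    (hε : 0 < ε) :
    ∃ (n : ℕ) (e : ℕ → A) (s : ℕ → ℝ), (∀ j, 0 ≤ e j) ∧ (∀ j, 0 ≤ s j) ∧
      ∑ j ∈ Finset.range n, e j = 1 ∧ ∑ j ∈ Finset.range n, (s j : ℂ) • e j = y ∧
      ‖∑ j ∈ Finset.range n, (f (s j) : ℂ) • e j - cfc f y‖ ≤ ε := by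
  obtain ⟨C, hC, hyC⟩ : ∃ C : ℝ, 0 < C ∧ ∀ t ∈ spectrum ℝ y, t / C ∈ Set.Icc (0 : ℝ) 1 := by
    refine ⟨‖y‖ + 1, by positivity, fun t ht => ?_⟩
    have h0 := spectrum_nonneg_of_nonneg hy ht
    have h1 : t ≤ ‖y‖ + 1 := by
      rcases subsingleton_or_nontrivial A with _ | _
      · simp [spectrum.of_subsingleton] at ht
      exact (Real.le_norm_self t).trans ((spectrum.norm_le_norm_of_mem ht).trans (by linarith))
    exact ⟨by positivity, (div_le_one (by positivity)).2 h1⟩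
  obtain ⟨n, hn, hB⟩ := exists_bernstein_near (f := fun x => f (C * x)) (by fun_prop) hε
  let p : ℕ → ℝ → ℝ := fun j t => (bernsteinPolynomial ℝ n j).eval (t / C)
  have hp : ∀ j, ContinuousOn (p j) (spectrum ℝ y) := fun j => by
    refine Continuous.continuousOn ?_
    exact (bernsteinPolynomial ℝ n j).continuous.comp (by fun_prop)
  have hsum : ∀ c : ℕ → ℝ, ∑ j ∈ Finset.range (n + 1), (c j : ℂ) • cfc (p j) y =
      cfc (fun t => ∑ j ∈ Finset.range (n + 1), c j * p j t) y := by
    intro c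
    have : (fun t => ∑ j ∈ Finset.range (n + 1), c j * p j t) =
        ∑ j ∈ Finset.range (n + 1), fun t => c j * p j t := by
      ext t
      simp
    rw [this, cfc_sum (fun j t => c j * p j t) y _ (fun j _ => (hp j).const_mul (c j))]
    refine Finset.sum_congr rfl fun j _ => ?_
    rw [cfc_const_mul _ _ _ (hp j), Complex.coe_smul]
  refine ⟨n + 1, fun j => cfc (p j) y, fun j => C * (j / n),
    fun j => cfc_nonneg fun t ht => ?_, fun j => by positivity, ?_, ?_, ?_⟩
  · exact bernstein_eval_nonneg (hyC t ht).1 (hyC t ht).2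
  · have := hsum fun _ => 1
    simp only [Complex.ofReal_one, one_smul, one_mul] at this
    rw [this]
    simp only [p, sum_bernstein_eq]
    exact cfc_const_one ℝ y
  · rw [hsum]
    have : (fun t => ∑ j ∈ Finset.range (n + 1), C * (j / n) * p j t) = fun t => t := by
      funext t
      have h := sum_mul_bernstein_eq n (t / C)
      have hn' : (n : ℝ) ≠ 0 := by exact_mod_cast hn
      calc _ = C / n * ∑ j ∈ Finset.range (n + 1),
            (j : ℝ) * (bernsteinPolynomial ℝ n j).eval (t / C) := by
            rw [Finset.mul_sum]
            exact Finset.sum_congr rfl fun j _ => by simp only [p]; ring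
        _ = t := by
            rw [h]
            field_simp
    rw [this, cfc_id' ℝ y]
  · have hps : ContinuousOn (fun t => ∑ j ∈ Finset.range (n + 1), f (C * (j / n)) * p j t)
        (spectrum ℝ y) := continuousOn_finsetSum _ fun j _ => (hp j).const_mul _
    rw [hsum (fun j => f (C * (j / n))), ← cfc_sub _ f y hps hf.continuousOn]
    refine norm_cfc_le hε.le fun t ht => ?_
    have := hB (t / C) (hyC t ht)
    rwa [mul_div_cancel₀ _ hC.ne'] at this

/-- If a positive form `Φ` has both marginals equal to `τ`, and `Φ(y, ·) = τ(w ·)`, then the entropy of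
`w` is at least that of `y`. -/
theorem trace_negMulLog_le {τ : StrongDual ℂ A} {Φ : A →ₗ[ℂ] A →ₗ[ℂ] ℂ}
    (hτ : ∀ a, 0 ≤ a → 0 ≤ τ a) (hΦ : ∀ a b, 0 ≤ a → 0 ≤ b → 0 ≤ Φ a b)
    (hΦ₁ : ∀ b, Φ 1 b = τ b) (hΦ₂ : ∀ a, Φ a 1 = τ a) {y w : A} (hy : 0 ≤ y) (hw : 0 ≤ w)
    (hyw : ∀ b, Φ y b = τ (w * b)) :
    (τ (cfc Real.negMulLog y)).re ≤ (τ (cfc Real.negMulLog w)).re := by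
  refine le_of_forall_pos_le_add fun ε hε => ?_
  obtain ⟨n, e, s, he, hs, he₁, hey, hf⟩ := exists_positive_decomposition hy
    Real.continuous_negMulLog (ε := ε / (‖τ‖ + 1)) (by positivity)
  have h1 := sum_negMulLog_le (Finset.range n) (τ := τ.toLinearMap) hτ hΦ hΦ₁ hw hyw
    (fun j _ => he j) (fun j _ => hs j) he₁ hey
  set b := ∑ j ∈ Finset.range n, (Real.negMulLog (s j) : ℂ) • e j with hb
  have h2 : ∑ j ∈ Finset.range n, (Real.negMulLog (s j) : ℂ) * Φ (e j) 1 = τ b := by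
    simp [hb, hΦ₂]
  rw [h2] at h1
  have h3 : ‖τ (b - cfc Real.negMulLog y)‖ ≤ ε := by
    refine (τ.le_opNorm _).trans ((mul_le_mul_of_nonneg_left hf (norm_nonneg _)).trans ?_)
    rw [mul_div_assoc', div_le_iff₀ (by positivity)]
    nlinarith
  have h4 := (abs_le.1 ((Complex.abs_re_le_norm _).trans h3)).1
  have h5 := (Complex.le_def.1 h1).1
  rw [map_sub, Complex.sub_re] at h4
  simp only [ContinuousLinearMap.coe_coe] at h5
  linarith

/-! ### Functionals dominated by a trace -/

/-- Hahn–Banach separation in a weak topology, where the functionals are given by elements of the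
paired space. -/
theorem exists_separating_element {E F : Type*} [AddCommGroup E] [Module ℂ E] [AddCommGroup F]
    [Module ℂ F] (B : E →ₗ[ℂ] F →ₗ[ℂ] ℂ) {S : Set (WeakBilin B)} {ψ : WeakBilin B}
    (hS : Convex ℝ S) (hSc : IsClosed S) (hψ : ψ ∉ S) :
    ∃ (b : F) (u : ℝ), (∀ φ ∈ S, (B φ b).re < u) ∧ u < (B ψ b).re := by
  obtain ⟨f, u, hfu, huf⟩ := RCLike.geometric_hahn_banach_closed_point (𝕜 := ℂ) hS hSc hψ
  obtain ⟨b, rfl⟩ := LinearMap.dualEmbedding_surjective B f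
  exact ⟨b, u, hfu, huf⟩

/-- A Radon–Nikodym theorem: a functional `0 ≤ φ ≤ C τ` is of the form `τ(w ·)` with `w ≥ 0`, provided
the functionals `τ(w ·)` with `0 ≤ w ≤ C` form a weak-⋆ closed set. -/
theorem exists_density_of_le {τ φ : StrongDual ℂ A} (hτ : ∀ a, 0 ≤ a → 0 ≤ τ a)
    (htr : ∀ a b, τ (a * b) = τ (b * a)) (hφ : ∀ a, 0 ≤ a → 0 ≤ φ a) {C : ℝ} (hC : 0 ≤ C)
    (hφτ : ∀ a, 0 ≤ a → φ a ≤ C * τ a)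
    (hclosed : IsClosed ((fun w : A => (StrongDual.toWeakDual
      (τ.comp (ContinuousLinearMap.mul ℂ A w)))) '' Set.Icc 0 (algebraMap ℝ A C))) :
    ∃ w : A, 0 ≤ w ∧ ∀ z, φ z = τ (w * z) := by
  set D : A → WeakDual ℂ A := fun w => StrongDual.toWeakDual
    (τ.comp (ContinuousLinearMap.mul ℂ A w)) with hD
  by_contra hne
  have hnot : StrongDual.toWeakDual φ ∉ D '' Set.Icc 0 (algebraMap ℝ A C) := by
    rintro ⟨w, hw, hwφ⟩
    exact hne ⟨w, hw.1, fun z => (DFunLike.congr_fun hwφ z).symm⟩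
  have hconv : Convex ℝ (D '' Set.Icc 0 (algebraMap ℝ A C)) := by
    let L : A →ₗ[ℝ] WeakDual ℂ A :=
      { toFun := D
        map_add' := fun a b => by
          refine DFunLike.ext _ _ fun z => ?_
          change τ ((a + b) * z) = τ (a * z) + τ (b * z)
          rw [add_mul, map_add]
        map_smul' := fun r a => by
          refine DFunLike.ext _ _ fun z => ?_
          change τ ((r • a) * z) = r • τ (a * z)
          rw [smul_mul_assoc, ← Complex.coe_smul, map_smul, Complex.coe_smul] }
    exact (convex_Icc 0 (algebraMap ℝ A C)).linear_image L
  obtain ⟨b, u, hu, hφb⟩ := exists_separating_element (topDualPairing ℂ A) hconv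
    hclosed hnot
  have hwb : ∀ w ∈ Set.Icc 0 (algebraMap ℝ A C), (τ (w * b)).re < u :=
    fun w hw => hu _ ⟨w, hw, rfl⟩
  change u < (φ b).re at hφb
  set a : A := (ℜ b : A) with ha
  have has : IsSelfAdjoint a := (ℜ b).2
  have key : ∀ ε : ℝ, 0 < ε → (φ b).re ≤ u + ε * (C * (τ 1).re) := by
    intro ε hε
    -- `g(a)` replaces `C` times the support projection of `a⁺`, which need not lie in a C⋆-algebra.
    -- It satisfies `g(a) a ≥ C (a⁺ - ε)`.
    let g : ℝ → ℝ := fun t => C * (t⁺ / (t⁺ + ε))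
    have hpos : ∀ t : ℝ, 0 < t⁺ + ε := fun t => by have := posPart_nonneg t; positivity
    have hpc : Continuous fun t : ℝ => t⁺ := by
      simp only [posPart_def]; fun_prop
    have hg : Continuous g :=
      continuous_const.mul (hpc.div (hpc.add continuous_const) fun t => (hpos t).ne')
    have hwmem : cfc g a ∈ Set.Icc 0 (algebraMap ℝ A C) := by
      refine ⟨cfc_nonneg fun t _ => ?_, cfc_le_algebraMap g C a (fun t _ => ?_)
        hg.continuousOn has⟩
      · exact mul_nonneg hC (div_nonneg (posPart_nonneg t) (hpos t).le)
      · exact mul_le_of_le_one_right hC ((div_le_one (hpos t)).2 (by linarith))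
    have h1 := hwb _ hwmem
    have h2 : (τ (cfc g a * b)).re = (τ (cfc g a * a)).re := by
      have := re_map_realPart (φ := (τ.comp (ContinuousLinearMap.mul ℂ A (cfc g a))).toLinearMap)
        (fun z hz => trace_mul_nonneg (τ := τ.toLinearMap) hτ htr hwmem.1 hz) b
      exact this.symm
    have h3 : (C : ℂ) • a⁺ ≤ cfc g a * a + ((ε * C : ℝ) : ℂ) • (1 : A) := by
      have e1 : (C : ℂ) • a⁺ = cfc (fun t : ℝ => C * t⁺) a := by
        rw [cfc_const_mul _ _ _ hpc.continuousOn, Complex.coe_smul, CFC.posPart_def,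
            cfcₙ_eq_cfc]
      have e2 : cfc g a * a + ((ε * C : ℝ) : ℂ) • (1 : A) = cfc (fun t => g t * t + ε * C) a := by
        rw [cfc_add_const _ _ _ (by fun_prop), cfc_mul g (fun t => t) a (by fun_prop)
          (by fun_prop), cfc_id' ℝ a, Algebra.algebraMap_eq_smul_one, Complex.coe_smul]
      rw [e1, e2]
      refine cfc_mono (fun t _ => ?_) (by fun_prop) (by fun_prop)
      rcases le_total 0 t with ht | ht
      · simp only [g, posPart_of_nonneg ht]
        have : t - ε ≤ t / (t + ε) * t := by
          rw [div_mul_eq_mul_div, le_div_iff₀ (by positivity)]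
          nlinarith
        nlinarith
      · simp only [g, posPart_of_nonpos ht]
        simp only [zero_div, mul_zero, zero_mul, zero_add]
        positivity
    have h4 := (Complex.le_def.1 (map_mono_of_nonneg (φ := τ.toLinearMap) hτ h3)).1
    have h5 := (Complex.le_def.1 (hφτ _ (CFC.posPart_nonneg a))).1
    have h6 : (φ b).re ≤ (φ a⁺).re := by
      have e1 : (φ a).re = (φ b).re := re_map_realPart (φ := φ.toLinearMap) hφ b
      have e2 := (Complex.nonneg_iff.1 (hφ a⁻ (CFC.negPart_nonneg a))).1
      rw [← CFC.posPart_sub_negPart a has, map_sub, Complex.sub_re] at e1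
      linarith
    simp only [map_add, map_smul, ContinuousLinearMap.coe_coe, smul_eq_mul, Complex.add_re,
      Complex.re_ofReal_mul] at h4 h5
    linarith
  have hlim : Filter.Tendsto (fun ε : ℝ => u + ε * (C * (τ 1).re))
      (nhdsWithin 0 (Set.Ioi 0)) (nhds (u + 0 * (C * (τ 1).re))) :=
    tendsto_nhdsWithin_of_tendsto_nhds (Continuous.tendsto (by fun_prop) 0)
  rw [zero_mul, add_zero] at hlim
  exact hφb.not_ge (ge_of_tendsto hlim
    (Filter.eventually_of_mem self_mem_nhdsWithin fun ε hε => key ε hε))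

end CStar

/-! ### Order intervals of a von Neumann algebra -/

section VonNeumann

variable {H : Type*} [NormedAddCommGroup H] [InnerProductSpace ℂ H] [CompleteSpace H]

theorem isPos_iff_nonneg {M : VonNeumannAlgebra H} {x : Alg M} : IsPos x ↔ 0 ≤ x :=
  (ContinuousLinearMap.nonneg_iff_isPositive _).symm

/-- The order of operators makes `M` a star-ordered ring: the square root of a positive element of `M`
lies in `M`, because `M` is a C⋆-algebra and the spectrum of an element does not depend on whether
it is taken in `M` or among all operators. -/
instance instStarOrderedRing (M : VonNeumannAlgebra H) : StarOrderedRing (Alg M) := by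
  refine StarOrderedRing.of_nonneg_iff' (fun {x y} h z => ?_) fun x => ⟨fun hx => ?_, ?_⟩
  · exact add_le_add_right (α := H →L[ℂ] H) h (z : H →L[ℂ] H)
  · have hx' : 0 ≤ (x : H →L[ℂ] H) := hx
    have hsa : IsSelfAdjoint x := Subtype.ext (IsSelfAdjoint.of_nonneg hx').star_eq
    have hsp : ∀ t ∈ spectrum ℝ x, 0 ≤ t := fun t ht => by
      refine spectrum_nonneg_of_nonneg hx' ?_
      rw [← spectrum.preimage_algebraMap ℂ] at ht ⊢
      rwa [Set.mem_preimage, ← StarSubalgebra.spectrum_eq M.toStarSubalgebra]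
    refine ⟨cfc Real.sqrt x, ?_⟩
    rw [(cfc_predicate Real.sqrt x : IsSelfAdjoint _).star_eq, ← cfc_mul Real.sqrt Real.sqrt x]
    conv_lhs => rw [← cfc_id' ℝ x]
    exact cfc_congr fun t ht => (Real.mul_self_sqrt (hsp t ht)).symm
  · rintro ⟨s, rfl⟩
    exact star_mul_self_nonneg (s : H →L[ℂ] H)

/-- The order interval `[0, C]` of `M` is compact in the weak operator topology. -/
theorem exists_weakOperatorLimit (M : VonNeumannAlgebra H) {C : ℝ} (hC : 0 ≤ C)
    (F : Ultrafilter (Alg M)) (hF : ∀ᶠ w in F, w ∈ Set.Icc (0 : Alg M) (algebraMap ℝ (Alg M) C)) :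
    ∃ w ∈ Set.Icc (0 : Alg M) (algebraMap ℝ (Alg M) C), ∀ ξ η : H,
      Filter.Tendsto (fun v : Alg M => ⟪η, (v : H →L[ℂ] H) ξ⟫_ℂ) F
        (nhds ⟪η, (w : H →L[ℂ] H) ξ⟫_ℂ) := by
  have hnorm : ∀ᶠ v : Alg M in F, ∀ ξ η : H,
      ‖⟪(v : H →L[ℂ] H) ξ, η⟫_ℂ‖ ≤ C * ‖ξ‖ * ‖η‖ := by
    filter_upwards [hF] with v hv ξ η
    have hv' : ‖(v : H →L[ℂ] H)‖ ≤ C :=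
      (CStarAlgebra.norm_le_iff_le_algebraMap v hC hv.1).2 hv.2
    exact (norm_inner_le_norm _ _).trans (mul_le_mul_of_nonneg_right
      (((v : H →L[ℂ] H).le_opNorm ξ).trans (mul_le_mul_of_nonneg_right hv' (norm_nonneg _)))
      (norm_nonneg _))
  have hlim : ∀ ξ η : H, ∃ c : ℂ, ‖c‖ ≤ C * ‖ξ‖ * ‖η‖ ∧
      Filter.Tendsto (fun v : Alg M => ⟪(v : H →L[ℂ] H) ξ, η⟫_ℂ) F (nhds c) := by
    intro ξ η
    have hK := (isCompact_closedBall (0 : ℂ) (C * ‖ξ‖ * ‖η‖)).ultrafilter_le_nhds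
      (F.map fun v : Alg M => ⟪(v : H →L[ℂ] H) ξ, η⟫_ℂ) (by
        rw [Filter.le_principal_iff, Ultrafilter.mem_coe, Ultrafilter.mem_map]
        filter_upwards [hnorm] with v hv
        simpa using hv ξ η)
    obtain ⟨c, hc, hcF⟩ := hK
    exact ⟨c, by simpa using hc, hcF⟩
  choose c hc hcF using hlim
  -- The limits of the matrix coefficients form a bounded sesquilinear form, hence an operator `T`.
  let B : H →L⋆[ℂ] H →L[ℂ] ℂ := LinearMap.mkContinuous₂
    (LinearMap.mk₂'ₛₗ (starRingEnd ℂ) (RingHom.id ℂ) c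
      (fun ξ ξ' η => tendsto_nhds_unique (hcF _ _) (by
        simpa [inner_add_left] using (hcF ξ η).add (hcF ξ' η)))
      (fun a ξ η => tendsto_nhds_unique (hcF _ _) (by
        simpa [inner_smul_left, mul_comm] using (hcF ξ η).const_mul (starRingEnd ℂ a)))
      (fun ξ η η' => tendsto_nhds_unique (hcF _ _) (by
        simpa [inner_add_right] using (hcF ξ η).add (hcF ξ η')))
      (fun a ξ η => tendsto_nhds_unique (hcF _ _) (by
        simpa [inner_smul_right] using (hcF ξ η).const_mul a))) C hc
  set T : H →L[ℂ] H := InnerProductSpace.continuousLinearMapOfBilin B with hT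
  have hTc : ∀ ξ η, ⟪T ξ, η⟫_ℂ = c ξ η := fun ξ η =>
    InnerProductSpace.continuousLinearMapOfBilin_apply B ξ η
  have hTlim : ∀ ξ η, Filter.Tendsto (fun v : Alg M => ⟪(v : H →L[ℂ] H) ξ, η⟫_ℂ) F
      (nhds ⟪T ξ, η⟫_ℂ) := fun ξ η => (hTc ξ η).symm ▸ hcF ξ η
  -- `T` commutes with the commutant of `M`, hence lies in `M` by the bicommutant property.
  have hTM : T ∈ M := by
    rw [← SetLike.mem_coe, ← M.centralizer_centralizer, Set.mem_centralizer_iff]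
    intro a ha
    refine ContinuousLinearMap.ext fun ξ => ext_inner_right ℂ fun η => ?_
    change ⟪a (T ξ), η⟫_ℂ = ⟪T (a ξ), η⟫_ℂ
    rw [← ContinuousLinearMap.adjoint_inner_right]
    refine tendsto_nhds_unique (hTlim ξ _) ((hTlim (a ξ) η).congr fun v => ?_)
    rw [ContinuousLinearMap.adjoint_inner_right]
    have := Set.mem_centralizer_iff.1 ha v v.2
    exact congrArg (fun S : H →L[ℂ] H => ⟪S ξ, η⟫_ℂ) this
  let w : Alg M := ⟨T, hTM⟩
  have hnonneg : ∀ {S : H →L[ℂ] H} {g : Alg M → H →L[ℂ] H}, (∀ᶠ v in F, 0 ≤ g v) →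
      (∀ ξ, Filter.Tendsto (fun v => ⟪g v ξ, ξ⟫_ℂ) F (nhds ⟪S ξ, ξ⟫_ℂ)) → 0 ≤ S := by
    intro S g hg hS
    rw [ContinuousLinearMap.nonneg_iff_isPositive, ContinuousLinearMap.isPositive_iff_complex]
    intro ξ
    have h0 : 0 ≤ ⟪S ξ, ξ⟫_ℂ := ge_of_tendsto (hS ξ) (by
      filter_upwards [hg] with v hv
      exact ((ContinuousLinearMap.nonneg_iff_isPositive _).1 hv).inner_nonneg_left ξ)
    obtain ⟨h1, h2⟩ := Complex.nonneg_iff.1 h0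
    exact ⟨Complex.ext rfl h2, h1⟩
  refine ⟨w, ⟨?_, ?_⟩, fun ξ η => ?_⟩
  · exact hnonneg (hF.mono fun v hv => hv.1) fun ξ => hTlim ξ ξ
  · rw [← sub_nonneg]
    refine hnonneg (g := fun v => ((algebraMap ℝ (Alg M) C - v : Alg M) : H →L[ℂ] H))
      (hF.mono fun v hv => sub_nonneg.2 hv.2) fun ξ => ?_
    have := (hTlim ξ ξ).const_sub ⟪((algebraMap ℝ (Alg M) C : Alg M) : H →L[ℂ] H) ξ, ξ⟫_ℂ
    simpa [inner_sub_left] using this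
  · have := (Complex.continuous_conj.tendsto _).comp (hTlim ξ η)
    simpa [Function.comp_def] using this

/-- A normal functional is weak operator continuous on order intervals. -/
theorem tendsto_of_isNormal {M : VonNeumannAlgebra H} {τ : StrongDual ℂ (Alg M)}
    (hτ : IsNormal τ) {C : ℝ} (hC : 0 ≤ C) {F : Filter (Alg M)}
    (hF : ∀ᶠ v in F, v ∈ Set.Icc (0 : Alg M) (algebraMap ℝ (Alg M) C)) {w : Alg M}
    (hw : ∀ ξ η : H, Filter.Tendsto (fun v : Alg M => ⟪η, (v : H →L[ℂ] H) ξ⟫_ℂ) F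
        (nhds ⟪η, (w : H →L[ℂ] H) ξ⟫_ℂ)) (z : Alg M) :
    Filter.Tendsto (fun v => τ (v * z)) F (nhds (τ (w * z))) := by
  obtain ⟨ξ, η, hξ, hη, hsum⟩ := hτ
  simp_rw [← fun x => (hsum x).tsum_eq]
  refine tendsto_tsum_of_dominated_convergence
    (bound := fun n => C * ‖(z : H →L[ℂ] H)‖ * (‖ξ n‖ ^ 2 + ‖η n‖ ^ 2))
    ((hξ.add hη).mul_left _) (fun n => hw _ _) ?_
  filter_upwards [hF] with v hv n
  have hv' : ‖(v : H →L[ℂ] H)‖ ≤ C :=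
    (CStarAlgebra.norm_le_iff_le_algebraMap v hC hv.1).2 hv.2
  calc ‖⟪η n, (v : H →L[ℂ] H) ((z : H →L[ℂ] H) (ξ n))⟫_ℂ‖
      ≤ ‖η n‖ * (C * (‖(z : H →L[ℂ] H)‖ * ‖ξ n‖)) := by
        refine (norm_inner_le_norm _ _).trans (mul_le_mul_of_nonneg_left ?_ (norm_nonneg _))
        refine ((v : H →L[ℂ] H).le_opNorm _).trans ?_
        exact mul_le_mul hv' ((z : H →L[ℂ] H).le_opNorm _) (norm_nonneg _) hC
    _ = C * ‖(z : H →L[ℂ] H)‖ * (‖ξ n‖ * ‖η n‖) := by ring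
    _ ≤ _ := by
        gcongr
        nlinarith [sq_nonneg (‖ξ n‖ - ‖η n‖), sq_nonneg ‖ξ n‖, sq_nonneg ‖η n‖]

/-- The functionals `τ(w ·)` with `w ∈ M`, `0 ≤ w ≤ C`, form a weak-⋆ closed set. -/
theorem isClosed_image_density_Icc {M : VonNeumannAlgebra H} {τ : StrongDual ℂ (Alg M)}
    (hτ : IsNormal τ) {C : ℝ} (hC : 0 ≤ C) :
    IsClosed ((fun w : Alg M => (StrongDual.toWeakDual
      (τ.comp (ContinuousLinearMap.mul ℂ (Alg M) w)))) ''
        Set.Icc 0 (algebraMap ℝ (Alg M) C)) := by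
  refine IsCompact.isClosed (isCompact_iff_ultrafilter_le_nhds'.2 fun G hG => ?_)
  have hF := Ultrafilter.ofComapInfPrincipal_mem hG
  have hFG := Ultrafilter.ofComapInfPrincipal_eq_of_map hG
  set F := Ultrafilter.ofComapInfPrincipal hG
  obtain ⟨w, hw, hlim⟩ := exists_weakOperatorLimit M hC F hF
  refine ⟨_, ⟨w, hw, rfl⟩, ?_⟩
  rw [← hFG, Ultrafilter.coe_map]
  exact tendsto_iff_forall_eval_tendsto_topDualPairing.2
    fun z => tendsto_of_isNormal hτ hC hF hlim z

/-! ### Positive forms with tracial marginals -/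

theorem density_injective {M : VonNeumannAlgebra H} {τ : StrongDual ℂ (Alg M)} (hτ : IsTrace τ) :
    Function.Injective (density τ) := by
  refine (injective_iff_map_eq_zero _).2 fun x hx => hτ.faithful x ?_
  rw [hτ.tracial]
  exact DFunLike.congr_fun hx (star x)

/-- Let `Φ` be a positive form on `M` with both marginals equal to `τ`. For `y ≥ 0` the functional
`Φ(y, ·)` is then given by a positive element of `M`, whose entropy is at least that of `y`. -/
theorem exists_density_entropy_le {M : VonNeumannAlgebra H} {τ : StrongDual ℂ (Alg M)}
    (hτ : IsTrace τ) {Φ : Alg M →ₗ[ℂ] StrongDual ℂ (Alg M)}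
    (hΦ : ∀ a b, 0 ≤ a → 0 ≤ b → 0 ≤ Φ a b) (hΦ₁ : ∀ b, Φ 1 b = τ b) (hΦ₂ : ∀ a, Φ a 1 = τ a)
    {y : Alg M} (hy : 0 ≤ y) :
    ∃ w : Alg M, 0 ≤ w ∧ density τ w = Φ y ∧ entropy τ y ≤ entropy τ w := by
  have hpos : ∀ a : Alg M, 0 ≤ a → 0 ≤ τ a := fun a ha => hτ.pos a (isPos_iff_nonneg.2 ha)
  obtain ⟨w, hw, hwy⟩ := exists_density_of_le (φ := Φ y) hpos hτ.tracial
    (fun b hb => hΦ y b hy hb) (norm_nonneg y) (fun b hb => by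
      have h := hΦ (algebraMap ℝ (Alg M) ‖y‖ - y) b
        (sub_nonneg.2 (IsSelfAdjoint.of_nonneg hy).le_algebraMap_norm_self) hb
      rwa [Algebra.algebraMap_eq_smul_one, ← Complex.coe_smul, map_sub, map_smul,
        sub_apply, smul_apply, hΦ₁, sub_nonneg,
        smul_eq_mul] at h)
    (isClosed_image_density_Icc hτ.normal (norm_nonneg y))
  refine ⟨w, hw, ContinuousLinearMap.ext fun z => (hwy z).symm, ?_⟩
  exact trace_negMulLog_le (Φ := (ContinuousLinearMap.coeLM ℂ).comp Φ) hpos hΦ hΦ₁ hΦ₂ hy hw hwy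

/-- The trace of a positive element is its `1`-norm. -/
theorem trace_eq_norm₁ {M : VonNeumannAlgebra H} {τ : StrongDual ℂ (Alg M)} (hτ : IsTrace τ)
    {x : Alg M} (hx : 0 ≤ x) : τ x = norm₁ τ x := by
  have h : absVal x = x := by
    have hsa : IsSelfAdjoint x := IsSelfAdjoint.of_nonneg hx
    have h2 : star x * x = cfc (fun t : ℝ => t * t) x := by
      rw [hsa.star_eq, cfc_mul (fun t : ℝ => t) (fun t => t) x, cfc_id' ℝ x]
    rw [absVal, h2, ← cfc_comp' Real.sqrt (fun t : ℝ => t * t) x]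
    conv_rhs => rw [← cfc_id' ℝ x]
    exact cfc_congr fun t ht => Real.sqrt_mul_self (spectrum_nonneg_of_nonneg hx ht)
  rw [norm₁, h]
  exact Complex.ext rfl (Complex.nonneg_iff.1 (hτ.pos x (isPos_iff_nonneg.2 hx))).2.symm

theorem IsAntipode.map_one {M : VonNeumannAlgebra H} {τ : StrongDual ℂ (Alg M)}
    {conv : Alg M →ₗ[ℂ] Alg M →ₗ[ℂ] L1 τ} {ρ : Alg M ≃ₗ[ℂ] Alg M} (hρ : IsAntipode τ conv ρ) :
    ρ 1 = 1 := by
  obtain ⟨u, hu⟩ := ρ.surjective 1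
  have := hρ.map_mul u 1
  rwa [mul_one, hu, mul_one, eq_comm] at this

end VonNeumann

end FrobeniusVN

open FrobeniusVN in
theorem theorem4p1 {H : Type*} [NormedAddCommGroup H] [InnerProductSpace ℂ H] [CompleteSpace H]
    (M : VonNeumannAlgebra H) (τ : StrongDual ℂ (FrobeniusVN.Alg M)) (k : ℝ)
    (conv : FrobeniusVN.Alg M →ₗ[ℂ] FrobeniusVN.Alg M →ₗ[ℂ] FrobeniusVN.L1 τ)
    (ρ : FrobeniusVN.Alg M ≃ₗ[ℂ] FrobeniusVN.Alg M)
    (hFN : FrobeniusVN.IsFNAlgebra M τ k conv ρ)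
    (x y : FrobeniusVN.Alg M) (hx : FrobeniusVN.IsPos x) (hy : FrobeniusVN.IsPos y)
    (hx₁ : FrobeniusVN.norm₁ τ x = k⁻¹) (hy₁ : FrobeniusVN.norm₁ τ y = k⁻¹)
    (θ : ℝ) (hθ : θ ∈ Set.Icc (0 : ℝ) 1) :
    ∃ w : FrobeniusVN.Alg M, FrobeniusVN.IsPos w ∧ FrobeniusVN.toL1 τ w = conv x y ∧
      θ * FrobeniusVN.entropy τ x + (1 - θ) * FrobeniusVN.entropy τ y ≤
        FrobeniusVN.entropy τ w := by
  obtain ⟨hk, hτ, hg, hρ⟩ := hFN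
  have hk' : (k : ℂ) ≠ 0 := by exact_mod_cast hk.ne'
  have hx0 := isPos_iff_nonneg.1 hx
  have hy0 := isPos_iff_nonneg.1 hy
  have hτx : (k : ℂ) * τ x = 1 := by
    rw [trace_eq_norm₁ hτ hx0, hx₁, Complex.ofReal_inv, mul_inv_cancel₀ hk']
  have hτy : (k : ℂ) * τ y = 1 := by
    rw [trace_eq_norm₁ hτ hy0, hy₁, Complex.ofReal_inv, mul_inv_cancel₀ hk']
  obtain ⟨w, hw, hwΦ, hyw⟩ := exists_density_entropy_le hτ (Φ := (L1 τ).subtype.comp (conv x))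
    (fun a b ha hb => hg.positivity x a hx (isPos_iff_nonneg.2 ha) b (isPos_iff_nonneg.2 hb))
    (fun b => by
      change pairing (conv x 1) b = τ b
      rw [hρ.reciprocity, hρ.map_one, hg.haar, hρ.trace_map, mul_right_comm, hτx, one_mul])
    (fun a => by
      change pairing (conv x a) 1 = τ a
      rw [hg.haar, hτx, one_mul]) hy0
  obtain ⟨w', -, hwΦ', hxw⟩ := exists_density_entropy_le hτ
    (Φ := (L1 τ).subtype.comp (conv.flip y))
    (fun a b ha hb => hg.positivity a y (isPos_iff_nonneg.2 ha) hy b (isPos_iff_nonneg.2 hb))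
    (fun b => by
      change pairing (conv 1 y) b = τ b
      rw [hρ.reciprocity, hρ.reciprocity, hρ.map_one, hg.haar, hρ.trace_map, hρ.trace_map,
        hρ.trace_map, hτy, one_mul])
    (fun a => by
      change pairing (conv a y) 1 = τ a
      rw [hg.haar, mul_right_comm, hτy, one_mul]) hx0
  obtain rfl : w = w' := density_injective hτ (hwΦ.trans hwΦ'.symm)
  refine ⟨w, isPos_iff_nonneg.2 hw, Subtype.ext hwΦ, ?_⟩
  have h1 := mul_le_mul_of_nonneg_left hxw hθ.1
  have h2 := mul_le_mul_of_nonneg_left hyw (sub_nonneg.2 hθ.2)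
  linarith
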